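/- Let $k$ be a commutative ring, let $\mathcal C$ be a small category with pairwise coproducts (every two objects have a coproduct; an initial object is not required), and write $\mathsf{sq}:\mathcal C\to\mathcal C$ for the functor $c\mapsto c\sqcup c$. A representation of $\mathcal C$ is a functor $\mathcal F:\mathcal C\to \mathsf{Mod}(k)$, and $\mathsf{lim}^n=\mathbf R^n\mathsf{lim}$ ($n\ge 0$) denotes the $n$-th right derived functor of $\mathsf{lim}:\mathsf{Mod}(k)^{\mathcal C}\to\mathsf{Mod}(k)$. The representation $\mathcal F$ is monoadditive if for all $c_1,c_2\in\mathcal C$ the canonical map $(\mathcal F(i_1),\mathcal F(i_2)):\mathcal F(c_1)\oplus\mathcal F(c_2)\to\mathcal F(c_1\sqcup c_2)$ is a monomorphism, where $i_1,i_2$ are the coproduct inclusions. Taking $c_1=c_2$ gives a natural transformation $\mathsf T_{\mathcal F}:\mathcal F\oplus\mathcal F\to\mathcal F\circ\mathsf{sq}$, and $\Sigma\mathcal F$ denotes its cokernel. A representation is $1$-monoadditive if it is monoadditive; for $n\ge 2$, it is $n$-monoadditive if it is monoadditive and $\Sigma\mathcal F$ is $(n-1)$-monoadditive. It is $\infty$-monoadditive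 if it is $n$-monoadditive for all $n\ge 1$. Then: 1. If $\mathcal F$ is monoadditive, then $\mathsf{lim}^n\mathcal F\cong\mathsf{lim}^{n-1}\,\Sigma\mathcal F$ for all $n\ge 0$, where $\mathsf{lim}^{-1}=0$; that is, $\mathsf{lim}^0\mathcal F=0$ and $\mathsf{lim}^{n+1}\mathcal F\cong\mathsf{lim}^{n}\,\Sigma\mathcal F$ for all $n\ge 0$. 2. If $n\ge 1$ and $\mathcal F$ is $n$-monoadditive, then $\mathsf{lim}^i\mathcal F=0$ for $0\le i<n$, and $\mathsf{lim}^{i}\mathcal F\cong\mathsf{lim}^{i-n}\,\Sigma^n\mathcal F$ for all $i\ge n$. 3. If $\mathcal F$ is $\infty$-monoadditive, then $\mathsf{lim}^i\mathcal F=0$ for all $i\ge 0$. -/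

import Mathlib

open CategoryTheory CategoryTheory.Limits

universe u

namespace HigherLimits

section Squaring

/-- The functor `sq : C ⥤ C`, `c ↦ c ⨿ c`. -/
@[simps]
noncomputable def sq (C : Type*) [Category* C] [HasBinaryCoproducts C] : C ⥤ C where
  obj c := c ⨿ c
  map f := coprod.map f f

variable {C : Type*} [Category* C] [HasBinaryCoproducts C]
variable {D : Type*} [Category* D] [HasBinaryCoproducts D]

/-- A functor is monoadditive if the canonical morphism
`(F(i₁), F(i₂)) : F(c₁) ⨿ F(c₂) ⟶ F(c₁ ⨿ c₂)` is a monomorphism for all `c₁`, `c₂`. -/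
def IsMonoadditive (F : C ⥤ D) : Prop :=
  ∀ c₁ c₂ : C, Mono (coprodComparison F c₁ c₂)

/-- The natural transformation `T_F : sq ∘ F ⟶ F ∘ sq` with components `(F(i₁), F(i₂))`. -/
@[simps]
noncomputable def sqComparison (F : C ⥤ D) : F ⋙ sq D ⟶ sq C ⋙ F where
  app c := coprodComparison F c c
  naturality _ _ f := (coprodComparison_natural F f f).symm

end Squaring

section EnoughInjectives

variable {C : Type u} [SmallCategory C] {A : Type*} [Category* A]

lemma enoughInjectives_discrete [HasPullbacks A] {ι : Type u} [EnoughInjectives A] :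
    EnoughInjectives (Discrete ι ⥤ A) where
  presentation F := ⟨
    { J := Discrete.functor fun i => Injective.under (F.obj ⟨i⟩)
      injective :=
        { factors := fun {X Y} g f _ => by
            have h : ∀ i : ι, ∃ a : Y.obj ⟨i⟩ ⟶ Injective.under (F.obj ⟨i⟩),
                f.app ⟨i⟩ ≫ a = g.app ⟨i⟩ := fun i =>
              ⟨Injective.factorThru (J := Injective.under (F.obj ⟨i⟩)) (g.app ⟨i⟩) (f.app ⟨i⟩),
                Injective.comp_factorThru _ _⟩
            choose a ha using h
            exact ⟨Discrete.natTrans fun i => a i.as, by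
              ext i
              exact ha i.as⟩ }
      f := Discrete.natTrans fun i => Injective.ι (F.obj i)
      mono := by
        have : ∀ i, Mono ((Discrete.natTrans (F := F)
            (G := Discrete.functor fun i => Injective.under (F.obj ⟨i⟩))
            fun i => Injective.ι (F.obj i)).app i) := fun i => by
          rw [Discrete.natTrans_app]
          exact Injective.ι_mono _
        exact NatTrans.mono_of_mono_app _ }⟩

/-- A category of functors from a small category to a category with limits and enough injectives
has enough injectives: use right Kan extensions from the discrete category of objects. -/
lemma enoughInjectives_functor [HasLimitsOfSize.{u, u} A] [HasPullbacks A] [EnoughInjectives A] :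
    EnoughInjectives (C ⥤ A) := by
  have := enoughInjectives_discrete (ι := C) (A := A)
  let L : Discrete C ⥤ C := Discrete.functor id
  have : ((Functor.whiskeringLeft _ _ A).obj L).PreservesMonomorphisms := ⟨fun f _ => by
    have : ∀ i, Mono ((((Functor.whiskeringLeft _ _ A).obj L).map f).app i) := fun i =>
      inferInstanceAs (Mono (f.app (L.obj i)))
    exact NatTrans.mono_of_mono_app _⟩
  have : ((Functor.whiskeringLeft _ _ A).obj L).ReflectsMonomorphisms := ⟨fun f h => by
    have : ∀ c, Mono (f.app c) := fun c =>
      inferInstanceAs (Mono ((((Functor.whiskeringLeft _ _ A).obj L).map f).app ⟨c⟩))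
    exact NatTrans.mono_of_mono_app _⟩
  exact EnoughInjectives.of_adjunction (L.ranAdjunction A)

end EnoughInjectives

section Representations

variable {C : Type u} [SmallCategory C] {k : Type u} [CommRing k]

instance : EnoughInjectives (C ⥤ ModuleCat.{u} k) :=
  enoughInjectives_functor

/-- The limit functor `Mod(k)^C ⥤ Mod(k)` is additive. -/
instance : (lim : (C ⥤ ModuleCat.{u} k) ⥤ ModuleCat.{u} k).Additive where
  map_add := limit.hom_ext fun j => by simp

/-- The higher limit `limⁿ F`: the `n`-th right derived functor of
`lim : Mod(k)^C ⥤ Mod(k)`, applied to the representation `F`. -/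
noncomputable def higherLim (n : ℕ) (F : C ⥤ ModuleCat.{u} k) : ModuleCat.{u} k :=
  ((lim : (C ⥤ ModuleCat.{u} k) ⥤ ModuleCat.{u} k).rightDerived n).obj F

variable [HasBinaryCoproducts C]

/-- The representation `ΣF`, the cokernel of `T_F : F ⊕ F ⟶ F ∘ sq`. -/
noncomputable def sigma (F : C ⥤ ModuleCat.{u} k) : C ⥤ ModuleCat.{u} k :=
  cokernel (sqComparison F)

/-- The iterate `ΣⁿF`. -/
noncomputable def sigmaIter (n : ℕ) (F : C ⥤ ModuleCat.{u} k) : C ⥤ ModuleCat.{u} k :=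
  sigma^[n] F

/-- `F` is `1`-monoadditive if it is monoadditive, and `(n+1)`-monoadditive (`n ≥ 1`) if it is
monoadditive and `ΣF` is `n`-monoadditive. (The notion is meant for `n ≥ 1`; for `n = 0` there is
no condition.) -/
def IsNMonoadditive : ℕ → (C ⥤ ModuleCat.{u} k) → Prop
  | 0, _ => True
  | 1, F => IsMonoadditive F
  | n + 2, F => IsMonoadditive F ∧ IsNMonoadditive (n + 1) (sigma F)

/-- `F` is `∞`-monoadditive if it is `n`-monoadditive for every `n ≥ 1`. -/
def IsInftyMonoadditive (F : C ⥤ ModuleCat.{u} k) : Prop :=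
  ∀ n : ℕ, 1 ≤ n → IsNMonoadditive n F

end Representations

end HigherLimits

/-! Identify `limⁿ F` with `Extⁿ(k, F)`, where `k` is the constant representation
(`nonempty_higherLim_equiv_ext`). On these groups the inclusions `F ⟶ F ∘ sq` induce the same map
(`comp_sqInl_eq`), and it is invertible with inverse the codiagonal (`comp_sqFold_sqInl`,
`comp_sqInl_sqFold`). Hence, up to this isomorphism, `T_F` acts on `Extⁿ(k, F ⊕ F)` as addition `(a,
b) ↦ a + b`: it is surjective, and its kernel is the antidiagonal, a copy of `Extⁿ(k, F)`. If `T_F`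
is mono, the long exact sequence of `F ⊕ F ⟶ F ∘ sq ⟶ ΣF` identifies `Extⁿ(k, ΣF)` with that kernel
in degree `n + 1` (`sigmaToExt_bijective`), and the kernel in degree `0` vanishes. The rest is
iteration. -/

namespace HigherLimits

open CategoryTheory.Abelian

/-! ### Limits as maps out of the constant representation. -/

section LimExt

variable {C : Type u} [SmallCategory C] {k : Type u} [CommRing k]

instance : HasExt.{u} (C ⥤ ModuleCat.{u} k) := hasExt_of_enoughInjectives _

variable (C k) in
/-- The constant representation with value `k`. -/
noncomputable abbrev constRep : C ⥤ ModuleCat.{u} k :=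
  (Functor.const C).obj (ModuleCat.of k k)

/-- The map out of the constant representation given by an element of the limit. -/
noncomputable def homOfLim (F : C ⥤ ModuleCat.{u} k) (x : (limit F : ModuleCat.{u} k)) :
    constRep C k ⟶ F where
  app c := ModuleCat.ofHom (LinearMap.toSpanSingleton k _ (limit.π F c x))
  naturality c d f := by
    ext
    rw [← limit.w F f]
    simp

lemma homOfLim_app_one (F : C ⥤ ModuleCat.{u} k) (x : (limit F : ModuleCat.{u} k)) (c : C) :
    ((homOfLim F x).app c).hom (1 : k) = limit.π F c x :=
  one_smul k _

lemma constRep_hom_ext {F : C ⥤ ModuleCat.{u} k} {f g : constRep C k ⟶ F}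
    (h : ∀ c, (f.app c).hom (1 : k) = (g.app c).hom (1 : k)) : f = g :=
  NatTrans.ext (funext fun c => ModuleCat.hom_ext (LinearMap.ext_ring (h c)))

/-- Maps out of the constant representation are elements of the limit. -/
noncomputable def limEquivHom (F : C ⥤ ModuleCat.{u} k) :
    (lim.obj F : ModuleCat.{u} k) ≃ₗ[k] (constRep C k ⟶ F) where
  toFun x := homOfLim F x
  map_add' x y := constRep_hom_ext fun c => by
    rw [homOfLim_app_one]
    exact ((limit.π F c).hom.map_add x y).trans
      (congrArg₂ (· + ·) (homOfLim_app_one F x c).symm (homOfLim_app_one F y c).symm)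
  map_smul' r x := constRep_hom_ext fun c => by
    rw [homOfLim_app_one]
    exact ((limit.π F c).hom.map_smul r x).trans
      (congrArg (r • ·) (homOfLim_app_one F x c).symm)
  invFun f := (limit.lift F ⟨_, f⟩).hom (1 : k)
  left_inv x := Concrete.limit_ext F _ _ fun c =>
    congr($(limit.lift_π (F := F) ⟨ModuleCat.of k k, homOfLim F x⟩ c) (1 : k)).trans
      (homOfLim_app_one F x c)
  right_inv f := constRep_hom_ext fun c => (homOfLim_app_one F _ c).trans
    congr($(limit.lift_π (F := F) ⟨ModuleCat.of k k, f⟩ c) (1 : k))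

lemma limEquivHom_map {F G : C ⥤ ModuleCat.{u} k} (g : F ⟶ G) (x : (lim.obj F : ModuleCat.{u} k)) :
    limEquivHom G (lim.map g x) = limEquivHom F x ≫ g :=
  constRep_hom_ext fun c => (homOfLim_app_one G _ c).trans <|
    congr($(limMap_π g c) x).trans (congrArg (g.app c) (homOfLim_app_one F x c).symm)

end LimExt

section ExtMk

variable {k : Type*} [CommRing k] {A : Type*} [Category* A] [Abelian A] [Linear k A] [HasExt.{u} A]
  {X Y : A} (R : InjectiveResolution Y)

lemma smul_extMk {n : ℕ} (r : k) (f : X ⟶ R.cocomplex.X n) (m : ℕ) (hm : n + 1 = m)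
    (hf : f ≫ R.cocomplex.d n m = 0) :
    r • R.extMk f m hm hf = R.extMk (r • f) m hm (by simp [hf]) := by
  -- Scaling a class is precomposition with `r • 𝟙 X`.
  have h := R.mk₀_comp_extMk f m hm hf (r • 𝟙 X)
  rw [Ext.mk₀_smul, Ext.smul_comp, Ext.mk₀_id_comp] at h
  simpa using h

end ExtMk

section Homology

variable {k : Type*} [CommRing k]

lemma nonempty_homology_equiv (S : ShortComplex (ModuleCat.{u} k)) {M : Type*} [AddCommGroup M]
    [Module k M] (φ : LinearMap.ker S.g.hom →ₗ[k] M) (hφ : Function.Surjective φ)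
    (h : ∀ x, φ x = 0 ↔ ∃ y, S.f y = x.1) : Nonempty (S.homology ≃ₗ[k] M) := by
  have h' : LinearMap.range S.moduleCatToCycles = LinearMap.ker φ := by
    ext x
    rw [LinearMap.mem_ker, h]
    exact exists_congr fun y => Subtype.ext_iff
  exact ⟨(S.moduleCatHomologyIso.toLinearEquiv.trans (Submodule.quotEquivOfEq _ _ h')).trans
    (φ.quotKerEquivOfSurjective hφ)⟩

end Homology

/-! ### Higher limits as Ext groups. -/

section LimExt

variable {C : Type u} [SmallCategory C] {k : Type u} [CommRing k]

/-- Cocycles in the complex of limits of an injective resolution represent classes in `Ext`. -/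
noncomputable def cyclesToExt {F : C ⥤ ModuleCat.{u} k} (R : InjectiveResolution F) (n : ℕ) :
    LinearMap.ker (lim.map (R.cocomplex.d n (n + 1)) :
      lim.obj (R.cocomplex.X n) ⟶ lim.obj (R.cocomplex.X (n + 1))).hom →ₗ[k]
      Ext (constRep C k) F n where
  toFun x := R.extMk (limEquivHom _ x.1) (n + 1) rfl (by
    rw [← limEquivHom_map, show lim.map (R.cocomplex.d n (n + 1)) x.1 = 0 from x.2, map_zero])
  map_add' x y := by
    rw [R.add_extMk]
    simp only [Submodule.coe_add, map_add]
  map_smul' r x := by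
    rw [RingHom.id_apply, smul_extMk]
    simp only [Submodule.coe_smul, map_smul]

lemma cyclesToExt_surjective {F : C ⥤ ModuleCat.{u} k} (R : InjectiveResolution F) (n : ℕ) :
    Function.Surjective (cyclesToExt R n) := fun α => by
  obtain ⟨f, hf, rfl⟩ := R.extMk_surjective α (n + 1) rfl
  obtain ⟨x, rfl⟩ := (limEquivHom _).surjective f
  refine ⟨⟨x, ?_⟩, rfl⟩
  rw [← limEquivHom_map, LinearEquiv.map_eq_zero_iff] at hf
  exact hf

lemma cyclesToExt_eq_zero_iff {F : C ⥤ ModuleCat.{u} k} (R : InjectiveResolution F) (n : ℕ)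
    (x : LinearMap.ker (lim.map (R.cocomplex.d (n + 1) (n + 1 + 1)) :
      lim.obj (R.cocomplex.X (n + 1)) ⟶ lim.obj (R.cocomplex.X (n + 1 + 1))).hom) :
    cyclesToExt R (n + 1) x = 0 ↔
      ∃ y : (lim.obj (R.cocomplex.X n) : ModuleCat.{u} k),
        lim.map (R.cocomplex.d n (n + 1)) y = x.1 := by
  rw [cyclesToExt, LinearMap.coe_mk, AddHom.coe_mk, R.extMk_eq_zero_iff _ _ _ _ n rfl,
    (limEquivHom (R.cocomplex.X n)).surjective.exists]
  simp only [← limEquivHom_map, EmbeddingLike.apply_eq_iff_eq]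

/-- The higher limits are the `Ext` groups out of the constant representation. -/
lemma nonempty_higherLim_equiv_ext (F : C ⥤ ModuleCat.{u} k) :
    ∀ n : ℕ, Nonempty (higherLim n F ≃ₗ[k] Ext (constRep C k) F n)
  -- Degree `0` has no incoming differential, so left exactness of `lim` is used instead.
  | 0 => ⟨(((lim : (C ⥤ ModuleCat.{u} k) ⥤ ModuleCat.{u} k).rightDerivedZeroIsoSelf.app
      F).toLinearEquiv.trans (limEquivHom F)).trans Ext.linearEquiv₀.symm⟩
  | n + 1 =>
    let R := injectiveResolution F
    let K := ((lim : (C ⥤ ModuleCat.{u} k) ⥤ ModuleCat.{u} k).mapHomologicalComplex _).obj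
      R.cocomplex
    let S := K.sc' n (n + 1) (n + 1 + 1)
    let e : higherLim (n + 1) F ≅ S.homology :=
      R.isoRightDerivedObj lim (n + 1) ≪≫ K.homologyIsoSc' n (n + 1) (n + 1 + 1) (by simp) (by simp)
    (nonempty_homology_equiv S (cyclesToExt R (n + 1)) (cyclesToExt_surjective R (n + 1))
      (cyclesToExt_eq_zero_iff R n)).map e.toLinearEquiv.trans

end LimExt

/-! ### Precomposition with `sq` on Ext out of the constant representation. -/

section SquareExt

variable {C : Type u} [SmallCategory C] [HasBinaryCoproducts C] {k : Type u} [CommRing k]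

/-- The first coproduct inclusion, as a natural transformation. -/
noncomputable def sqInl (F : C ⥤ ModuleCat.{u} k) : F ⟶ sq C ⋙ F where
  app c := F.map coprod.inl
  naturality c d f := CommSq.w <| F.map_commSq
    (show CommSq f (coprod.inl : c ⟶ c ⨿ c) coprod.inl (coprod.map f f) from ⟨by simp⟩)

/-- The second coproduct inclusion, as a natural transformation. -/
noncomputable def sqInr (F : C ⥤ ModuleCat.{u} k) : F ⟶ sq C ⋙ F where
  app c := F.map coprod.inr
  naturality c d f := CommSq.w <| F.map_commSq
    (show CommSq f (coprod.inr : c ⟶ c ⨿ c) coprod.inr (coprod.map f f) from ⟨by simp⟩)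

/-- The codiagonal, as a natural transformation. -/
noncomputable def sqFold (F : C ⥤ ModuleCat.{u} k) : sq C ⋙ F ⟶ F where
  app c := F.map (coprod.desc (𝟙 c) (𝟙 c))
  naturality c d f := CommSq.w <| F.map_commSq
    (show CommSq (coprod.map f f) (coprod.desc (𝟙 c) (𝟙 c)) (coprod.desc (𝟙 d) (𝟙 d)) f from
      ⟨by simp⟩)

lemma sqInl_sqFold (F : C ⥤ ModuleCat.{u} k) : sqInl F ≫ sqFold F = 𝟙 F := by
  ext c : 2
  change F.map coprod.inl ≫ F.map (coprod.desc (𝟙 c) (𝟙 c)) = 𝟙 (F.obj c)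
  rw [← F.map_comp, coprod.inl_desc, F.map_id]

/-- By naturality both composites at `c` are the component of `f` at `c ⨿ c`, since a constant
functor sends both inclusions to the identity. -/
lemma constRep_comp_sqInl {F : C ⥤ ModuleCat.{u} k} (f : constRep C k ⟶ F) :
    f ≫ sqInl F = f ≫ sqInr F := by
  ext c : 2
  exact (f.naturality (coprod.inl : c ⟶ c ⨿ c)).symm.trans
    (f.naturality (coprod.inr : c ⟶ c ⨿ c))

lemma sqInl_naturality {F G : C ⥤ ModuleCat.{u} k} (f : F ⟶ G) :
    sqInl F ≫ Functor.whiskerLeft (sq C) f = f ≫ sqInl G := by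
  ext c : 2
  exact f.naturality (coprod.inl : c ⟶ c ⨿ c)

lemma sqInr_naturality {F G : C ⥤ ModuleCat.{u} k} (f : F ⟶ G) :
    sqInr F ≫ Functor.whiskerLeft (sq C) f = f ≫ sqInr G := by
  ext c : 2
  exact f.naturality (coprod.inr : c ⟶ c ⨿ c)

/-- Both coproduct inclusions induce the same map on `Ext` out of the constant representation. -/
lemma comp_sqInl_eq (n : ℕ) : ∀ {F : C ⥤ ModuleCat.{u} k} (α : Ext (constRep C k) F n),
    α.comp (Ext.mk₀ (sqInl F)) (add_zero n) = α.comp (Ext.mk₀ (sqInr F)) (add_zero n) := by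
  induction n with
  | zero =>
    intro F α
    obtain ⟨f, rfl⟩ := Ext.addEquiv₀.symm.surjective α
    simp [constRep_comp_sqInl]
  | succ n ih =>
    intro F α
    -- Dimension shift: with `F` embedded in an injective, `α` is the connecting image of a class
    -- `β` on the cokernel.
    let S : ShortComplex (C ⥤ ModuleCat.{u} k) := .mk _ _ (cokernel.condition (Injective.ι F))
    have hS : S.ShortExact := { exact := ShortComplex.exact_cokernel _ }
    have : Injective S.X₂ := inferInstanceAs (Injective (Injective.under F))
    let Φ := (Functor.whiskeringLeft C C (ModuleCat.{u} k)).obj (sq C)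
    have hS' : (S.map Φ).ShortExact := hS.map_of_exact Φ
    let l : S ⟶ S.map Φ :=
      { τ₁ := sqInl S.X₁
        τ₂ := sqInl S.X₂
        τ₃ := sqInl S.X₃
        comm₁₂ := sqInl_naturality S.f
        comm₂₃ := sqInl_naturality S.g }
    let r : S ⟶ S.map Φ :=
      { τ₁ := sqInr S.X₁
        τ₂ := sqInr S.X₂
        τ₃ := sqInr S.X₃
        comm₁₂ := sqInr_naturality S.f
        comm₂₃ := sqInr_naturality S.g }
    obtain ⟨β, rfl⟩ := Ext.covariant_sequence_exact₁ _ hS α (Ext.eq_zero_of_injective _) rfl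
    have h : ∀ φ : S ⟶ S.map Φ, (β.comp hS.extClass rfl).comp (Ext.mk₀ φ.τ₁) (add_zero (n + 1)) =
        (β.comp (Ext.mk₀ φ.τ₃) (add_zero n)).comp hS'.extClass rfl := fun φ => by
      rw [Ext.comp_assoc_of_third_deg_zero, hS.extClass_naturality hS' φ,
        Ext.comp_assoc_of_second_deg_zero]
    refine (h l).trans (Eq.trans ?_ (h r).symm)
    exact congrArg (fun γ => Ext.comp γ hS'.extClass rfl) (ih β)

/-- The natural transformation `F ∘ sq ∘ sq ⟶ F ∘ sq` sending the first three of the four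
summands to the first one, and the last to the second one. -/
noncomputable def sqSqFold (F : C ⥤ ModuleCat.{u} k) : sq C ⋙ sq C ⋙ F ⟶ sq C ⋙ F where
  app c := F.map (coprod.desc (coprod.desc coprod.inl coprod.inl) (𝟙 (c ⨿ c)))
  naturality c d f := CommSq.w <| F.map_commSq
    (show CommSq (coprod.map (coprod.map f f) (coprod.map f f))
      (coprod.desc (coprod.desc coprod.inl coprod.inl) (𝟙 (c ⨿ c)))
      (coprod.desc (coprod.desc coprod.inl coprod.inl) (𝟙 (d ⨿ d))) (coprod.map f f) from
      ⟨by ext <;> simp⟩)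

lemma sqInl_sqSqFold (F : C ⥤ ModuleCat.{u} k) :
    sqInl (sq C ⋙ F) ≫ sqSqFold F = sqFold F ≫ sqInl F := by
  ext c : 2
  let i : c ⟶ c ⨿ c := coprod.inl
  exact CommSq.w <| F.map_commSq (show CommSq (coprod.map i i) (coprod.desc (𝟙 c) (𝟙 c))
    (coprod.desc (coprod.desc i i) (𝟙 (c ⨿ c))) i from ⟨by ext <;> simp [i, coprod.inl_desc, coprod.inr_desc]⟩)

lemma sqInr_sqSqFold (F : C ⥤ ModuleCat.{u} k) :
    sqInr (sq C ⋙ F) ≫ sqSqFold F = 𝟙 _ := by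
  ext c : 2
  let i : c ⟶ c ⨿ c := coprod.inl
  let j : c ⟶ c ⨿ c := coprod.inr
  have h : coprod.map j j ≫ coprod.desc (coprod.desc i i) (𝟙 (c ⨿ c)) = 𝟙 (c ⨿ c) := by
    ext <;> simp [i, j, coprod.inr_desc]
  exact (F.map_comp _ _).symm.trans ((congrArg F.map h).trans (F.map_id (c ⨿ c)))

/-- The two inclusions for `F ∘ sq` agree on `α`; followed by `sqSqFold` they become `sqFold ≫
sqInl` and the identity. -/
lemma comp_sqFold_sqInl {n : ℕ} {F : C ⥤ ModuleCat.{u} k} (α : Ext (constRep C k) (sq C ⋙ F) n) :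
    (α.comp (Ext.mk₀ (sqFold F)) (add_zero n)).comp (Ext.mk₀ (sqInl F)) (add_zero n) = α := by
  have h := comp_sqInl_eq n α
  replace h := congrArg (fun γ => Ext.comp γ (Ext.mk₀ (sqSqFold F)) (add_zero n)) h
  simpa only [Ext.comp_assoc_of_third_deg_zero, Ext.mk₀_comp_mk₀, sqInl_sqSqFold, sqInr_sqSqFold,
    Ext.comp_mk₀_id] using h

lemma comp_sqInl_sqFold {n : ℕ} {F : C ⥤ ModuleCat.{u} k} (α : Ext (constRep C k) F n) :
    (α.comp (Ext.mk₀ (sqInl F)) (add_zero n)).comp (Ext.mk₀ (sqFold F)) (add_zero n) = α := by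
  rw [Ext.comp_assoc_of_third_deg_zero, Ext.mk₀_comp_mk₀, sqInl_sqFold, Ext.comp_mk₀_id]

end SquareExt

/-! ### The long exact sequence of `ΣF` and its iteration. -/

section Sigma

variable {C : Type u} [SmallCategory C] {k : Type u} [CommRing k]

/-- The first summand inclusion `F ⟶ F ⊕ F`. -/
noncomputable def sumInl (F : C ⥤ ModuleCat.{u} k) : F ⟶ F ⋙ sq (ModuleCat.{u} k) where
  app _ := coprod.inl
  naturality _ _ f := (coprod.inl_map (F.map f) (F.map f)).symm

/-- The second summand inclusion `F ⟶ F ⊕ F`. -/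
noncomputable def sumInr (F : C ⥤ ModuleCat.{u} k) : F ⟶ F ⋙ sq (ModuleCat.{u} k) where
  app _ := coprod.inr
  naturality _ _ f := (coprod.inr_map (F.map f) (F.map f)).symm

/-- The natural transformation out of `F ⊕ F` with given components. -/
noncomputable def sumDesc {F G : C ⥤ ModuleCat.{u} k} (a b : F ⟶ G) :
    F ⋙ sq (ModuleCat.{u} k) ⟶ G where
  app c := coprod.desc (a.app c) (b.app c)
  naturality c d f := by
    change coprod.map (F.map f) (F.map f) ≫ _ = coprod.desc _ _ ≫ _
    rw [coprod.map_desc, coprod.desc_comp, a.naturality, b.naturality]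

lemma sum_hom_ext {F G : C ⥤ ModuleCat.{u} k} {a b : F ⋙ sq (ModuleCat.{u} k) ⟶ G}
    (hl : sumInl F ≫ a = sumInl F ≫ b) (hr : sumInr F ≫ a = sumInr F ≫ b) : a = b :=
  NatTrans.ext (funext fun c => coprod.hom_ext (NatTrans.congr_app hl c) (NatTrans.congr_app hr c))

lemma sumInl_sumDesc {F G : C ⥤ ModuleCat.{u} k} (a b : F ⟶ G) : sumInl F ≫ sumDesc a b = a := by
  ext c : 2
  exact coprod.inl_desc _ _

lemma sumInr_sumDesc {F G : C ⥤ ModuleCat.{u} k} (a b : F ⟶ G) : sumInr F ≫ sumDesc a b = b := by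
  ext c : 2
  exact coprod.inr_desc _ _

variable (F : C ⥤ ModuleCat.{u} k)

/-- The first projection `F ⊕ F ⟶ F`. -/
noncomputable abbrev sumFst : F ⋙ sq (ModuleCat.{u} k) ⟶ F :=
  sumDesc (𝟙 F) 0

/-- The second projection `F ⊕ F ⟶ F`. -/
noncomputable abbrev sumSnd : F ⋙ sq (ModuleCat.{u} k) ⟶ F :=
  sumDesc 0 (𝟙 F)

lemma sumFst_sumInl_add : sumFst F ≫ sumInl F + sumSnd F ≫ sumInr F = 𝟙 _ := by
  apply sum_hom_ext
  · rw [Preadditive.comp_add, ← Category.assoc, ← Category.assoc, sumInl_sumDesc, sumInl_sumDesc,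
      Category.id_comp, zero_comp, add_zero, Category.comp_id]
  · rw [Preadditive.comp_add, ← Category.assoc, ← Category.assoc, sumInr_sumDesc, sumInr_sumDesc,
      Category.id_comp, zero_comp, zero_add, Category.comp_id]

variable [HasBinaryCoproducts C]

lemma sumInl_sqComparison : sumInl F ≫ sqComparison F = sqInl F := by
  ext c : 2
  exact coprod.inl_desc _ _

lemma sumInr_sqComparison : sumInr F ≫ sqComparison F = sqInr F := by
  ext c : 2
  exact coprod.inr_desc _ _

variable {F}

lemma IsMonoadditive.mono_sqComparison (hF : IsMonoadditive F) :
    Mono (sqComparison F) :=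
  have : ∀ c, Mono ((sqComparison F).app c) := fun c => hF c c
  NatTrans.mono_of_mono_app _

/-- Classes on `F ⊕ F` with opposite components are killed by `T_F`. -/
lemma comp_sumInl_sub_sumInr_comp_sqComparison {n : ℕ} (α : Ext (constRep C k) F n) :
    (α.comp (Ext.mk₀ (sumInl F - sumInr F)) (add_zero n)).comp
      (Ext.mk₀ (sqComparison F)) (add_zero n) = 0 := by
  rw [Ext.comp_assoc_of_third_deg_zero, Ext.mk₀_comp_mk₀, Preadditive.sub_comp,
    sumInl_sqComparison, sumInr_sqComparison, sub_eq_add_neg, Ext.mk₀_add, Ext.mk₀_neg,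
    Ext.comp_add, Ext.comp_neg, comp_sqInl_eq, add_neg_cancel]

/-- A class on `F ⊕ F` which is killed by `T_F` and has zero first component is zero. -/
lemma eq_zero_of_comp_sqComparison {n : ℕ}
    {α : Ext (constRep C k) (F ⋙ sq (ModuleCat.{u} k)) n}
    (h : α.comp (Ext.mk₀ (sqComparison F)) (add_zero n) = 0)
    (h₁ : α.comp (Ext.mk₀ (sumFst F)) (add_zero n) = 0) : α = 0 := by
  have hα : α = (α.comp (Ext.mk₀ (sumSnd F)) (add_zero n)).comp
      (Ext.mk₀ (sumInr F)) (add_zero n) := by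
    conv_lhs => rw [← Ext.comp_mk₀_id α, ← sumFst_sumInl_add, Ext.mk₀_add, Ext.comp_add,
      ← Ext.mk₀_comp_mk₀, ← Ext.mk₀_comp_mk₀, ← Ext.comp_assoc_of_third_deg_zero, h₁,
      Ext.zero_comp, zero_add, ← Ext.comp_assoc_of_third_deg_zero]
  set β := α.comp (Ext.mk₀ (sumSnd F)) (add_zero n)
  -- Only the second component `β` survives; `h` says that its image under `sqInl` vanishes, and
  -- `sqFold` undoes `sqInl`.
  rw [hα, Ext.comp_assoc_of_third_deg_zero, Ext.mk₀_comp_mk₀, sumInr_sqComparison,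
    ← comp_sqInl_eq] at h
  rw [hα, ← comp_sqInl_sqFold β, h, Ext.zero_comp, Ext.zero_comp]

/-- The short complex `F ⊕ F ⟶ F ∘ sq ⟶ ΣF`. -/
noncomputable abbrev sigmaShortComplex (F : C ⥤ ModuleCat.{u} k) :
    ShortComplex (C ⥤ ModuleCat.{u} k) :=
  .mk (X₃ := sigma F) (sqComparison F) (cokernel.π _) (cokernel.condition _)

lemma IsMonoadditive.shortExact (hF : IsMonoadditive F) : (sigmaShortComplex F).ShortExact :=
  have := hF.mono_sqComparison
  { exact := ShortComplex.exact_cokernel _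
    epi_g := inferInstanceAs (Epi (cokernel.π _)) }

/-- The degree-raising map `Extⁿ(k, ΣF) → Extⁿ⁺¹(k, F)`. -/
noncomputable def IsMonoadditive.sigmaToExt (hF : IsMonoadditive F) (n : ℕ) :
    Ext (constRep C k) (sigma F) n →ₗ[k] Ext (constRep C k) F (n + 1) :=
  (Ext.bilinearCompOfLinear k _ _ _ n 1 (n + 1) rfl).flip
    (hF.shortExact.extClass.comp (Ext.mk₀ (sumFst F)) (add_zero 1))

lemma IsMonoadditive.sigmaToExt_apply (hF : IsMonoadditive F) {n : ℕ}
    (α : Ext (constRep C k) (sigma F) n) :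
    hF.sigmaToExt n α =
      (α.comp hF.shortExact.extClass rfl).comp (Ext.mk₀ (sumFst F)) (add_zero (n + 1)) :=
  (Ext.comp_assoc_of_third_deg_zero _ _ _ _).symm

lemma IsMonoadditive.sigmaToExt_bijective (hF : IsMonoadditive F) (n : ℕ) :
    Function.Bijective (hF.sigmaToExt n) := by
  constructor
  · refine (injective_iff_map_eq_zero _).2 fun α hα => ?_
    rw [hF.sigmaToExt_apply] at hα
    have h : (α.comp hF.shortExact.extClass rfl).comp (Ext.mk₀ (sqComparison F))
        (add_zero (n + 1)) = 0 := by
      rw [Ext.comp_assoc_of_third_deg_zero]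
      exact (congrArg (α.comp · rfl) hF.shortExact.extClass_comp).trans
        (Ext.comp_zero _ _ _ _ _)
    obtain ⟨β, rfl⟩ := Ext.covariant_sequence_exact₃ _ hF.shortExact α rfl
      (eq_zero_of_comp_sqComparison h hα)
    -- Every class on `F ∘ sq` comes from the first summand through `T_F`, hence dies in `ΣF`.
    rw [← comp_sqFold_sqInl β, ← sumInl_sqComparison, ← Ext.mk₀_comp_mk₀,
      ← Ext.comp_assoc_of_third_deg_zero, Ext.comp_assoc_of_third_deg_zero, Ext.mk₀_comp_mk₀,
      (sigmaShortComplex F).zero, Ext.mk₀_zero, Ext.comp_zero]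
  · intro α
    -- The antidiagonal class `(α, -α)` is killed by `T_F`, so it is a connecting image; its first
    -- component is `α`.
    obtain ⟨β, hβ⟩ := Ext.covariant_sequence_exact₁ _ hF.shortExact _
      (comp_sumInl_sub_sumInr_comp_sqComparison α) rfl
    refine ⟨β, ?_⟩
    rw [hF.sigmaToExt_apply, hβ, Ext.comp_assoc_of_third_deg_zero, Ext.mk₀_comp_mk₀,
      Preadditive.sub_comp, sumInl_sumDesc, sumInr_sumDesc, sub_zero, Ext.comp_mk₀_id]

lemma IsMonoadditive.nonempty_iso (hF : IsMonoadditive F) (n : ℕ) :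
    Nonempty (higherLim (n + 1) F ≅ higherLim n (sigma F)) := by
  obtain ⟨e₁⟩ := nonempty_higherLim_equiv_ext F (n + 1)
  obtain ⟨e₂⟩ := nonempty_higherLim_equiv_ext (sigma F) n
  exact ⟨(e₁.trans ((LinearEquiv.ofBijective _ (hF.sigmaToExt_bijective n)).symm.trans
    e₂.symm)).toModuleIso⟩

/-- In degree `0` the mono `T_F` is injective on Hom, so `(α, -α)`, which it kills, is already zero.
-/
lemma IsMonoadditive.isZero_higherLim_zero (hF : IsMonoadditive F) :
    IsZero (higherLim 0 F) := by
  obtain ⟨e⟩ := nonempty_higherLim_equiv_ext F 0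
  have := hF.mono_sqComparison
  have h (α : Ext (constRep C k) F 0) : α = 0 := by
    have hα := (injective_iff_map_eq_zero _).1
      (Ext.postcomp_mk₀_injective_of_mono (constRep C k) (sqComparison F)) _
      (comp_sumInl_sub_sumInr_comp_sqComparison α)
    replace hα := congrArg (Ext.comp · (Ext.mk₀ (sumFst F)) (add_zero 0)) hα
    simpa only [Ext.comp_assoc_of_third_deg_zero, Ext.mk₀_comp_mk₀, Preadditive.sub_comp,
      sumInl_sumDesc, sumInr_sumDesc, sub_zero, Ext.comp_mk₀_id, Ext.zero_comp] using hα
  have : Subsingleton (Ext (constRep C k) F 0) := subsingleton_of_forall_eq 0 h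
  have := e.toEquiv.subsingleton
  exact ModuleCat.isZero_of_subsingleton _

lemma IsNMonoadditive.isMonoadditive {n : ℕ} {F : C ⥤ ModuleCat.{u} k}
    (hF : IsNMonoadditive (n + 1) F) : IsMonoadditive F :=
  match n, hF with
  | 0, hF => hF
  | _ + 1, hF => hF.1

lemma IsNMonoadditive.sigma {n : ℕ} {F : C ⥤ ModuleCat.{u} k}
    (hF : IsNMonoadditive (n + 1) F) : IsNMonoadditive n (sigma F) :=
  match n, hF with
  | 0, _ => trivial
  | _ + 1, hF => hF.2

lemma IsNMonoadditive.isZero_higherLim {n : ℕ} : ∀ {F : C ⥤ ModuleCat.{u} k},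
    IsNMonoadditive n F → ∀ i < n, IsZero (higherLim i F) := by
  induction n with
  | zero => exact fun _ i hi => absurd hi i.not_lt_zero
  | succ n ih =>
    rintro F hF (_ | i) hi
    · exact hF.isMonoadditive.isZero_higherLim_zero
    · obtain ⟨e⟩ := hF.isMonoadditive.nonempty_iso i
      exact (ih hF.sigma i (Nat.lt_of_succ_lt_succ hi)).of_iso e

lemma IsNMonoadditive.nonempty_iso {n : ℕ} : ∀ {F : C ⥤ ModuleCat.{u} k},
    IsNMonoadditive n F → ∀ i, Nonempty (higherLim (i + n) F ≅ higherLim i (sigmaIter n F)) := by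
  induction n with
  | zero => exact fun _ i => ⟨Iso.refl _⟩
  | succ n ih =>
    intro F hF i
    obtain ⟨e₁⟩ := hF.isMonoadditive.nonempty_iso (i + n)
    obtain ⟨e₂⟩ := ih hF.sigma i
    -- Composable by definition: `sigma^[n + 1] F` unfolds to `sigma^[n] (sigma F)`.
    exact ⟨e₁ ≪≫ e₂⟩

end Sigma

end HigherLimits

theorem mainTheorem2 {k : Type u} [CommRing k] {C : Type u} [SmallCategory C]
    [HasBinaryCoproducts C] (F : C ⥤ ModuleCat.{u} k) :
    (HigherLimits.IsMonoadditive F →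
      IsZero (HigherLimits.higherLim 0 F) ∧
      ∀ n : ℕ, Nonempty
        (HigherLimits.higherLim (n + 1) F ≅ HigherLimits.higherLim n (HigherLimits.sigma F))) ∧
    (∀ n : ℕ, 1 ≤ n → HigherLimits.IsNMonoadditive n F →
      (∀ i : ℕ, i < n → IsZero (HigherLimits.higherLim i F)) ∧
      ∀ i : ℕ, Nonempty
        (HigherLimits.higherLim (i + n) F ≅
          HigherLimits.higherLim i (HigherLimits.sigmaIter n F))) ∧
    (HigherLimits.IsInftyMonoadditive F → ∀ i : ℕ, IsZero (HigherLimits.higherLim i F)) :=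
  ⟨fun hF => ⟨hF.isZero_higherLim_zero, hF.nonempty_iso⟩,
    fun _ _ hF => ⟨hF.isZero_higherLim, hF.nonempty_iso⟩,
    fun hF i => (hF (i + 1) (Nat.succ_pos i)).isZero_higherLim i i.lt_succ_self⟩
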